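/- Strings are finite binary strings, $|x|$ is the length of $x$. A description method is a partial computable function $D$ from strings to strings; $C_D(x)$ is the length of the shortest $p$ with $D(p)=x$ ($\infty$ if there is none). $D$ is optimal if for every description method $D'$ there is $c$ with $C_D(x)\le C_{D'}(x)+c$ for all $x$. Fix any optimal $D$ and let $C=C_D$ be the plain Kolmogorov complexity, $d(y)=|y|-C(y)$, and $$\bar d(x)=\inf\{d(y)\mid x\text{ is a prefix of }y\},$$ where $y$ ranges over (finite) strings. Let $\mathbf 0'$ be the halting problem (the universal enumerable set). A $\mathbf 0'$-Martin-Löf test is a uniformly $\mathbf 0'$-enumerable sequence of sets of strings $V_0,V_1,\dots$ such that for every $c$ the open set $U_c=\bigcup_{x\in V_c}\Omega_x$ has uniform Bernoulli measure at most $2^{-c}$, where $\Omega_x$ is the set of infinite binary sequences with prefix $x$. A sequence $\omega\in\{0,1\}^{\mathbb N}$ is Martin-Löf $\mathbf 0'$-random (2-random) if no such test satisfies $\omega\in\bigcap_c U_c$. Theorem. An infinite binary sequence $\omega$ is Martin-Löf $\mathbf 0'$-random if and only if the quantities $\bar d(x)$, for all prefixes $x$ of $\omega$, are bounded by a common constant,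 i.e. there is $c$ with $\bar d(x)\le c$ for every finite prefix $x$ of $\omega$. -/

import Mathlib

open MeasureTheory

/-! ### Plain Kolmogorov complexity of binary strings -/

/-- The plain complexity of the string `x` with respect to the description method `D`: the least
length of a string `p` with `D p = x` (and `⊤` if there is none). -/
noncomputable def plainComplexity (D : List Bool →. List Bool) (x : List Bool) : ℕ∞ :=
  ⨅ p : List Bool, ⨅ _ : x ∈ D p, (p.length : ℕ∞)

/-- Every description bounds the complexity. -/
theorem plainComplexity_le {D : List Bool →. List Bool} {x p : List Bool} (h : x ∈ D p) :
    plainComplexity D x ≤ (p.length : ℕ∞) :=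
  iInf₂_le (f := fun (p : List Bool) (_ : x ∈ D p) => (p.length : ℕ∞)) p h

/-- `D` is an optimal description method: a partial computable function from strings to strings
whose complexity is minimal, up to an additive constant, among all partial computable
functions. -/
def IsOptimalMethod (D : List Bool →. List Bool) : Prop :=
  Partrec D ∧ ∀ D' : List Bool →. List Bool, Partrec D' →
    ∃ c : ℕ, ∀ x : List Bool, plainComplexity D x ≤ plainComplexity D' x + c

/-- The randomness deficiency `d(x) = |x| - C(x)`. (For an optimal `D` the complexity is finite,
so that `ENat.toNat` is its value.) -/
noncomputable def deficiency (D : List Bool →. List Bool) (x : List Bool) : ℤ :=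
  (x.length : ℤ) - ((plainComplexity D x).toNat : ℤ)

/-- The infimum of the deficiencies `d(y)` over all finite extensions `y` of `x`. (For an
optimal `D` the set is bounded below, so that this is its greatest lower bound.) -/
noncomputable def extDeficiency (D : List Bool →. List Bool) (x : List Bool) : ℤ :=
  sInf {d : ℤ | ∃ y : List Bool, x <+: y ∧ d = deficiency D y}

/-- For an optimal method, complexity is at most length plus a constant. -/
theorem IsOptimalMethod.le_length {D : List Bool →. List Bool} (hD : IsOptimalMethod D) :
    ∃ c : ℕ, ∀ x : List Bool, plainComplexity D x ≤ ((x.length + c : ℕ) : ℕ∞) := by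
  obtain ⟨c, hc⟩ := hD.2 (fun x => Part.some x) Partrec.some
  refine ⟨c, fun x => (hc x).trans ?_⟩
  push_cast
  gcongr
  exact plainComplexity_le (Part.mem_some x)

/-- For an optimal method, all complexities are finite. -/
theorem IsOptimalMethod.ne_top {D : List Bool →. List Bool} (hD : IsOptimalMethod D)
    (x : List Bool) : plainComplexity D x ≠ ⊤ := by
  obtain ⟨c, hc⟩ := hD.le_length
  exact ne_top_of_le_ne_top (ENat.natCast_ne_top _) (hc x)

/-- For an optimal method, `extDeficiency` is a true infimum. -/
theorem IsOptimalMethod.isGLB {D : List Bool →. List Bool} (hD : IsOptimalMethod D)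
    (x : List Bool) :
    IsGLB {d : ℤ | ∃ y : List Bool, x <+: y ∧ d = deficiency D y} (extDeficiency D x) := by
  obtain ⟨c, hc⟩ := hD.le_length
  refine isGLB_csInf ⟨_, x, List.prefix_refl x, rfl⟩ ⟨-(c : ℤ), ?_⟩
  rintro _ ⟨y, -, rfl⟩
  have h := ENat.toNat_le_of_le_natCast (hc y)
  unfold deficiency
  omega

/-- A universal description method: `1 … 1 0 p`, with `e` leading ones, describes the output of
the `e`-th program on `p`. -/
def universalMethod (q : List Bool) : Part (List Bool) :=
  ((Denumerable.ofNat Nat.Partrec.Code (q.idxOf false)).eval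
    (Encodable.encode (q.drop (q.idxOf false + 1)))).bind
      fun n => (Encodable.decode (α := List Bool) n : Part (List Bool))

/-- Optimal description methods exist. -/
theorem isOptimalMethod_universalMethod : IsOptimalMethod universalMethod := by
  constructor
  · have hi : Primrec fun q : List Bool => q.idxOf false :=
      Primrec.list_idxOf.comp (Primrec.const false) Primrec.id
    have h1 : Computable fun q : List Bool =>
        Denumerable.ofNat Nat.Partrec.Code (q.idxOf false) :=
      ((Primrec.ofNat Nat.Partrec.Code).comp hi).to_comp
    have h2 : Computable fun q : List Bool =>
        Encodable.encode (q.drop (q.idxOf false + 1)) :=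
      (Primrec.encode.comp
        (Primrec.list_drop.comp (Primrec.succ.comp hi) Primrec.id)).to_comp
    exact (Nat.Partrec.Code.eval_part.comp h1 h2).bind
      ((Computable.decode.comp Computable.snd).ofOption)
  · intro D' hD'
    obtain ⟨e, he⟩ := Nat.Partrec.Code.exists_code.1 hD'
    refine ⟨Encodable.encode e + 1, fun x => ?_⟩
    by_cases hx : plainComplexity D' x = ⊤
    · simp [hx]
    obtain ⟨p, hp, hl⟩ : ∃ p, x ∈ D' p ∧ plainComplexity D' x = (p.length : ℕ∞) := by
      by_contra hcon
      push Not at hcon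
      obtain ⟨m, hm⟩ := ENat.ne_top_iff_exists.1 hx
      have hle : ((m + 1 : ℕ) : ℕ∞) ≤ plainComplexity D' x := by
        refine le_iInf₂ fun p hp => ?_
        have h1 : plainComplexity D' x ≤ p.length := plainComplexity_le hp
        have h2 := hcon p hp
        rw [← hm] at h1 h2
        norm_cast at h1 h2 ⊢
        omega
      rw [← hm] at hle
      norm_cast at hle
      omega
    rw [hl]
    have key : x ∈ universalMethod
        (List.replicate (Encodable.encode e) true ++ false :: p) := by
      have hidx : (List.replicate (Encodable.encode e) true ++ false :: p).idxOf false
          = Encodable.encode e := by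
        rw [List.idxOf_append_of_notMem (by simp [List.mem_replicate])]
        simp
      have hdrop : (List.replicate (Encodable.encode e) true ++ false :: p).drop
          (Encodable.encode e + 1) = p := by
        rw [List.drop_append]
        simp
      unfold universalMethod
      rw [hidx, hdrop, Denumerable.ofNat_encode, he]
      simp only [Encodable.encodek, Part.coe_some, Part.bind_some, Part.mem_bind_iff,
        Part.mem_map_iff, Part.mem_coe]
      exact ⟨_, ⟨x, hp, rfl⟩, Encodable.encodek x⟩
    refine (plainComplexity_le key).trans ?_
    simp only [List.length_append, List.length_replicate, List.length_cons]
    norm_cast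
    omega

/-! ### Martin-Löf randomness relative to the halting problem -/

/-- The universal enumerable set: the pairs `⟨e, n⟩` such that the `e`-th program halts
on `n`. -/
def haltingSet : Set ℕ :=
  {m | ((Denumerable.ofNat Nat.Partrec.Code m.unpair.1).eval m.unpair.2).Dom}

open scoped Classical in
/-- The oracle `0'`: the (total) characteristic function of the universal enumerable set. -/
noncomputable def zeroJump : ℕ →. ℕ :=
  fun m => Part.some (if m ∈ haltingSet then 1 else 0)

/-- A predicate is enumerable with oracle `O` if it is the domain of a partial function that is
recursive in `O`. -/
def REPredIn {α : Type*} [Primcodable α] (O : ℕ →. ℕ) (p : α → Prop) : Prop :=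
  RecursiveIn {O} fun a => Part.assert (p a) fun _ => Part.some ()

/-- The uniform Bernoulli measure on the Cantor space of infinite binary sequences. -/
noncomputable def coinMeasure : Measure (ℕ → Bool) :=
  Measure.infinitePi fun _ : ℕ => (PMF.uniformOfFintype Bool).toMeasure

/-- The initial segment of length `n` of an infinite sequence. -/
def initSeg (ω : ℕ → Bool) (n : ℕ) : List Bool :=
  (List.range n).map ω

/-- The interval `Ω_x` of all infinite sequences that start with the string `x`. -/
def cantorInterval (x : List Bool) : Set (ℕ → Bool) :=
  {ω | initSeg ω x.length = x}

/-- The open set generated by a set of strings. -/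
def openOf (S : Set (List Bool)) : Set (ℕ → Bool) :=
  ⋃ x ∈ S, cantorInterval x

/-- A Martin-Löf test relative to `O`: a uniformly `O`-enumerable sequence of sets of strings
such that the `c`-th one generates an open set of measure at most `2 ^ (-c)`. -/
def IsMLTest (O : ℕ →. ℕ) (V : ℕ → Set (List Bool)) : Prop :=
  REPredIn O (fun a : ℕ × List Bool => a.2 ∈ V a.1) ∧
    ∀ c : ℕ, coinMeasure (openOf (V c)) ≤ 2⁻¹ ^ c

/-- `ω` is Martin-Löf random relative to `O`: no Martin-Löf test relative to `O` covers it at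
every level. -/
def IsMLRandom (O : ℕ →. ℕ) (ω : ℕ → Bool) : Prop :=
  ∀ V : ℕ → Set (List Bool), IsMLTest O V → ∃ c : ℕ, ω ∉ openOf (V c)

/-! By Post's theorem, enumerability in `zeroJump` is the same as having a `Σ₂` definition, so both
implications are about tests whose sets have the form `∃ k, ∀ m, R`.

Random implies bounded. Let `U_c` be the enumerable set of strings `y` with `C(y) < |y| - c`;
counting programs, its density at every length is at most `2 ^ (-c)`. If the extended deficiency of
`x` exceeds `c`, all extensions of `x` lie in `U_c`. The set of such `x` has a `Π₂` definition,
which does not make it a test, so it is covered greedily: strings are examined one after another,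
and a string is accepted if the extensions of accepted strings, together with `U_c`, still have
density at most `2 ^ (-c)` at every length. A violation is an enumerable event, so `zeroJump`
decides each step. A string with all extensions in `U_c` adds nothing new and is always accepted
(`exists_isMLTest_of_density`).

Bounded implies random. Given a `Σ₂` test, stage `n` approximates it by the pairs (string, witness)
not refuted by any `m < n`, and lists the strings of length `n` that extend an unrefuted string, in
order of the pairs. A true pair survives forever, while each of the finitely many earlier pairs is
eventually refuted unless its string is in the test set. For large `n`, the measure bound therefore
gives every extension of a test string a small index (`StagedTest.exists_index`), hence a short
description. Level `2 * c` saves `2 * c` bits, of which `c + 1` pay for writing `c` in unary. -/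

open Encodable

/-! ### `Σ₂` predicates -/

/-- A predicate is `Σ₂` if it has the form `∃ k, ∀ m, R a k m` with `R` primitive recursive. -/
def IsSigmaTwo {α : Type*} [Primcodable α] (p : α → Prop) : Prop :=
  ∃ R : α × ℕ × ℕ → Prop, PrimrecPred R ∧ ∀ a, p a ↔ ∃ k, ∀ m, R (a, k, m)

namespace IsSigmaTwo

variable {α β : Type*} [Primcodable α] [Primcodable β]

theorem of_eq {p q : α → Prop} (hp : IsSigmaTwo p) (h : ∀ a, p a ↔ q a) : IsSigmaTwo q :=
  (funext fun a => propext (h a) : p = q) ▸ hp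

theorem comp {p : β → Prop} (hp : IsSigmaTwo p) {f : α → β} (hf : Primrec f) :
    IsSigmaTwo fun a => p (f a) := by
  obtain ⟨R, hR, h⟩ := hp
  exact ⟨fun q => R (f q.1, q.2),
    hR.comp ((hf.comp Primrec.fst).pair Primrec.snd), fun a => h (f a)⟩

/-- A predicate `∃ k, R a k` with `R` primitive recursive is `Σ₂`. -/
theorem of_exists {R : α × ℕ → Prop} (hR : PrimrecPred R) :
    IsSigmaTwo fun a => ∃ k, R (a, k) :=
  ⟨fun q => R (q.1, q.2.1),
    hR.comp (Primrec.fst.pair (Primrec.fst.comp Primrec.snd)), fun a => by simp⟩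

/-- A predicate `∀ m, R a m` with `R` primitive recursive is `Σ₂`. -/
theorem of_forall {R : α × ℕ → Prop} (hR : PrimrecPred R) :
    IsSigmaTwo fun a => ∀ m, R (a, m) :=
  ⟨fun q => R (q.1, q.2.2),
    hR.comp (Primrec.fst.pair (Primrec.snd.comp Primrec.snd)), fun a => by simp⟩

theorem of_primrecPred {p : α → Prop} (hp : PrimrecPred p) : IsSigmaTwo p :=
  (of_exists (R := fun q : α × ℕ => p q.1) (hp.comp Primrec.fst)).of_eq fun a => by simp

theorem of_primrec_eq [DecidableEq β] {f g : α → β} (hf : Primrec f) (hg : Primrec g) :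
    IsSigmaTwo fun a => f a = g a :=
  of_primrecPred (Primrec.eq.comp hf hg)

theorem and {p q : α → Prop} (hp : IsSigmaTwo p) (hq : IsSigmaTwo q) :
    IsSigmaTwo fun a => p a ∧ q a := by
  obtain ⟨R, hR, h⟩ := hp
  obtain ⟨S, hS, h'⟩ := hq
  have hk : Primrec fun x : α × ℕ × ℕ => x.2.1.unpair :=
    Primrec.unpair.comp (Primrec.fst.comp Primrec.snd)
  have hm : Primrec fun x : α × ℕ × ℕ => x.2.2 := Primrec.snd.comp Primrec.snd
  -- One witness packs the two given ones; the universal variable is shared.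
  refine ⟨fun x => R (x.1, x.2.1.unpair.1, x.2.2) ∧ S (x.1, x.2.1.unpair.2, x.2.2),
    (hR.comp (Primrec.fst.pair ((Primrec.fst.comp hk).pair hm))).and
      (hS.comp (Primrec.fst.pair ((Primrec.snd.comp hk).pair hm))), fun a => ?_⟩
  simp only [h, h']
  constructor
  · rintro ⟨⟨k, hk⟩, l, hl⟩
    exact ⟨Nat.pair k l, fun m => by simpa using ⟨hk m, hl m⟩⟩
  · rintro ⟨k, hk⟩
    exact ⟨⟨_, fun m => (hk m).1⟩, _, fun m => (hk m).2⟩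

theorem or {p q : α → Prop} (hp : IsSigmaTwo p) (hq : IsSigmaTwo q) :
    IsSigmaTwo fun a => p a ∨ q a := by
  obtain ⟨R, hR, h⟩ := hp
  obtain ⟨S, hS, h'⟩ := hq
  have hk : Primrec fun x : α × ℕ × ℕ => x.2.1.unpair :=
    Primrec.unpair.comp (Primrec.fst.comp Primrec.snd)
  have hm : Primrec fun x : α × ℕ × ℕ => (x.1, x.2.1.unpair.2, x.2.2) :=
    Primrec.fst.pair ((Primrec.snd.comp hk).pair (Primrec.snd.comp Primrec.snd))
  have h0 : PrimrecPred fun x : α × ℕ × ℕ => x.2.1.unpair.1 = 0 :=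
    Primrec.eq.comp (Primrec.fst.comp hk) (Primrec.const 0)
  -- The first component of the witness is a tag that selects the disjunct, so the choice is made
  -- before `m` is quantified.
  refine ⟨fun x => (x.2.1.unpair.1 = 0 ∧ R (x.1, x.2.1.unpair.2, x.2.2)) ∨
      (¬ x.2.1.unpair.1 = 0 ∧ S (x.1, x.2.1.unpair.2, x.2.2)),
    (h0.and (hR.comp hm)).or (h0.not.and (hS.comp hm)), fun a => ?_⟩
  simp only [h, h']
  constructor
  · rintro (⟨k, hk⟩ | ⟨k, hk⟩)
    · exact ⟨Nat.pair 0 k, fun m => by simpa using hk m⟩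
    · exact ⟨Nat.pair 1 k, fun m => by simpa using hk m⟩
  · rintro ⟨k, hk⟩
    by_cases hk0 : k.unpair.1 = 0
    · exact .inl ⟨k.unpair.2, fun m => by simpa [hk0] using hk m⟩
    · exact .inr ⟨k.unpair.2, fun m => by simpa [hk0] using hk m⟩

theorem ex [Inhabited β] {p : α × β → Prop} (hp : IsSigmaTwo p) :
    IsSigmaTwo fun a => ∃ b, p (a, b) := by
  obtain ⟨R, hR, h⟩ := hp
  have hk : Primrec fun x : α × ℕ × ℕ => x.2.1.unpair :=
    Primrec.unpair.comp (Primrec.fst.comp Primrec.snd)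
  have hb : Primrec fun x : α × ℕ × ℕ => (decode (α := β) x.2.1.unpair.1).getD default :=
    Primrec.option_getD.comp (Primrec.decode.comp (Primrec.fst.comp hk)) (Primrec.const _)
  refine ⟨fun x => R ((x.1, (decode (α := β) x.2.1.unpair.1).getD default),
      x.2.1.unpair.2, x.2.2),
    hR.comp ((Primrec.fst.pair hb).pair
      ((Primrec.snd.comp hk).pair (Primrec.snd.comp Primrec.snd))), fun a => ?_⟩
  simp only [h]
  constructor
  · rintro ⟨b, k, hk⟩
    exact ⟨Nat.pair (encode b) k, fun m => by simpa using hk m⟩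
  · rintro ⟨k, hk⟩
    exact ⟨_, _, hk⟩

/-- Boundedly many witnesses fit into one coded list, and `m` then packs the index `i` with the
inner universal variable. -/
theorem forall_lt {p : α × ℕ → Prop} (hp : IsSigmaTwo p) {f : α → ℕ} (hf : Primrec f) :
    IsSigmaTwo fun a => ∀ i < f a, p (a, i) := by
  obtain ⟨R, hR, h⟩ := hp
  have hm : Primrec fun x : α × ℕ × ℕ => x.2.2.unpair :=
    Primrec.unpair.comp (Primrec.snd.comp Primrec.snd)
  have hl : Primrec fun x : α × ℕ × ℕ =>
      ((decode (α := List ℕ) x.2.1).getD []).getD x.2.2.unpair.1 0 :=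
    (Primrec.list_getD 0).comp (Primrec.option_getD.comp
      (Primrec.decode.comp (Primrec.fst.comp Primrec.snd)) (Primrec.const _))
      (Primrec.fst.comp hm)
  refine ⟨fun x => ¬ x.2.2.unpair.1 < f x.1 ∨ R ((x.1, x.2.2.unpair.1),
      ((decode (α := List ℕ) x.2.1).getD []).getD x.2.2.unpair.1 0, x.2.2.unpair.2),
    (PrimrecPred.not (Primrec.nat_lt.comp (Primrec.fst.comp hm) (hf.comp Primrec.fst))).or
      (hR.comp ((Primrec.fst.pair (Primrec.fst.comp hm)).pair
        (hl.pair (Primrec.snd.comp hm)))), fun a => ?_⟩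
  simp only [h]
  constructor
  · intro H
    choose! g hg using H
    refine ⟨encode ((List.range (f a)).map g), fun m => ?_⟩
    by_cases hm : m.unpair.1 < f a
    · right
      simpa [List.getD, hm] using hg _ hm m.unpair.2
    · exact .inl hm
  · rintro ⟨k, hk⟩ i hi
    exact ⟨_, fun m => by simpa [hi] using hk (Nat.pair i m)⟩

/-- Iterating a `Σ₂` relation `step a j` between numbers, starting from a `Σ₂` relation `init a`,
gives a `Σ₂` relation. -/
theorem chain {init : α × ℕ → Prop} (hinit : IsSigmaTwo init)
    {step : (α × ℕ) × ℕ × ℕ → Prop} (hstep : IsSigmaTwo step) :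
    IsSigmaTwo fun x : (α × ℕ) × ℕ => ∃ l : List ℕ, init (x.1.1, l.getD 0 0) ∧
      (∀ j < x.1.2, step ((x.1.1, j), l.getD j 0, l.getD (j + 1) 0)) ∧ l.getD x.1.2 0 = x.2 := by
  have ha : Primrec fun x : ((α × ℕ) × ℕ) × List ℕ => x.1.1.1 :=
    Primrec.fst.comp (Primrec.fst.comp Primrec.fst)
  have hn : Primrec fun x : ((α × ℕ) × ℕ) × List ℕ => x.1.1.2 :=
    Primrec.snd.comp (Primrec.fst.comp Primrec.fst)
  have hl : Primrec₂ fun (l : List ℕ) j => l.getD j 0 := Primrec.list_getD 0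
  refine ex (β := List ℕ) (p := fun x : ((α × ℕ) × ℕ) × List ℕ =>
    init (x.1.1.1, x.2.getD 0 0) ∧ (∀ j < x.1.1.2,
      step ((x.1.1.1, j), x.2.getD j 0, x.2.getD (j + 1) 0)) ∧ x.2.getD x.1.1.2 0 = x.1.2) ?_
  refine (hinit.comp (ha.pair (hl.comp Primrec.snd (Primrec.const 0)))).and (.and ?_ ?_)
  · refine forall_lt (p := fun y : (((α × ℕ) × ℕ) × List ℕ) × ℕ =>
      step ((y.1.1.1.1, y.2), y.1.2.getD y.2 0, y.1.2.getD (y.2 + 1) 0)) ?_ hn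
    have hll : Primrec fun y : (((α × ℕ) × ℕ) × List ℕ) × ℕ => y.1.2 :=
      Primrec.snd.comp Primrec.fst
    exact hstep.comp (((ha.comp Primrec.fst).pair Primrec.snd).pair
      ((hl.comp hll Primrec.snd).pair (hl.comp hll (Primrec.succ.comp Primrec.snd))))
  · exact of_primrec_eq (hl.comp Primrec.snd hn) (Primrec.snd.comp Primrec.fst)

end IsSigmaTwo

/-- A chain for a sequence of relations is determined by a relation that the recursion
satisfies. -/
theorem exists_list_chain_iff {init : ℕ → Prop} {step : ℕ → ℕ → ℕ → Prop} {G : ℕ → ℕ → Prop}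
    (h0 : ∀ s, G 0 s ↔ init s) (h1 : ∀ j s, G (j + 1) s ↔ ∃ t, G j t ∧ step j t s) (n s : ℕ) :
    (∃ l : List ℕ, init (l.getD 0 0) ∧ (∀ j < n, step j (l.getD j 0) (l.getD (j + 1) 0)) ∧
      l.getD n 0 = s) ↔ G n s := by
  constructor
  · rintro ⟨l, hl0, hl, rfl⟩
    have : ∀ j ≤ n, G j (l.getD j 0) := by
      intro j
      induction j with
      | zero => exact fun _ => (h0 _).2 hl0
      | succ j ih => exact fun hj => (h1 _ _).2 ⟨_, ih (by omega), hl j (by omega)⟩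
    exact this n le_rfl
  · intro h
    have : ∃ g : ℕ → ℕ, init (g 0) ∧ (∀ j < n, step j (g j) (g (j + 1))) ∧ g n = s := by
      induction n generalizing s with
      | zero => exact ⟨fun _ => s, (h0 s).1 h, by simp, rfl⟩
      | succ n ih =>
        obtain ⟨t, ht, hts⟩ := (h1 _ _).1 h
        obtain ⟨g, hg0, hg, rfl⟩ := ih t ht
        refine ⟨fun i => if i ≤ n then g i else s, by simpa using hg0, fun j hj => ?_, by simp⟩
        rcases Nat.lt_succ_iff_lt_or_eq.1 hj with hj' | rfl
        · simpa [hj'.le, Nat.succ_le_of_lt hj'] using hg j hj'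
        · simpa using hts
    obtain ⟨g, hg0, hg, rfl⟩ := this
    refine ⟨(List.range (n + 1)).map g, by simpa [List.getD] using hg0, fun j hj => ?_,
      by simp [List.getD]⟩
    have : j < n + 1 := by omega
    simpa [List.getD, this, hj] using hg j hj

/-! ### Enumerability relative to the halting problem -/

section

variable {α : Type*} [Primcodable α]

open Nat.Partrec (Code)

/-- A partial function that is recursive in functions with `Σ₂` graph has a `Σ₂` graph. -/
theorem isSigmaTwo_graph_of_recursiveIn {O : Set (ℕ →. ℕ)}
    (hO : ∀ g ∈ O, IsSigmaTwo fun x : ℕ × ℕ => x.2 ∈ g x.1) {f : ℕ →. ℕ}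
    (hf : Nat.RecursiveIn O f) : IsSigmaTwo fun x : ℕ × ℕ => x.2 ∈ f x.1 := by
  have u1 : Primrec fun x : ℕ × ℕ => x.1.unpair.1 :=
    Primrec.fst.comp (Primrec.unpair.comp Primrec.fst)
  have u2 : Primrec fun x : ℕ × ℕ => x.1.unpair.2 :=
    Primrec.snd.comp (Primrec.unpair.comp Primrec.fst)
  induction hf with
  | zero =>
    refine (IsSigmaTwo.of_primrec_eq Primrec.snd (Primrec.const 0)).of_eq fun a => ?_
    exact Part.mem_some_iff.symm
  | succ =>
    refine (IsSigmaTwo.of_primrec_eq Primrec.snd (Primrec.succ.comp Primrec.fst)).of_eq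
      fun a => ?_
    exact Part.mem_some_iff.symm
  | left =>
    refine (IsSigmaTwo.of_primrec_eq Primrec.snd u1).of_eq fun a => ?_
    exact Part.mem_some_iff.symm
  | right =>
    refine (IsSigmaTwo.of_primrec_eq Primrec.snd u2).of_eq fun a => ?_
    exact Part.mem_some_iff.symm
  | oracle g hg => exact hO g hg
  | pair _ _ hf hh =>
    refine ((hf.comp (Primrec.fst.pair
      (Primrec.fst.comp (Primrec.unpair.comp Primrec.snd)))).and (hh.comp (Primrec.fst.pair
      (Primrec.snd.comp (Primrec.unpair.comp Primrec.snd))))).of_eq fun x => ?_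
    obtain ⟨a, b⟩ := x
    simp only [Seq.seq, Part.map_eq_map, Part.mem_bind_iff, Part.mem_map_iff]
    constructor
    · rintro ⟨h1, h2⟩
      exact ⟨_, ⟨_, h1, rfl⟩, _, h2, Nat.pair_unpair _⟩
    · rintro ⟨_, ⟨c, h1, rfl⟩, d, h2, rfl⟩
      simpa using ⟨h1, h2⟩
  | @comp f h _ _ hf hh =>
    refine (IsSigmaTwo.ex (β := ℕ) (p := fun y : (ℕ × ℕ) × ℕ => y.2 ∈ h y.1.1 ∧ y.1.2 ∈ f y.2)
      ((hh.comp ((Primrec.fst.comp Primrec.fst).pair Primrec.snd)).and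
        (hf.comp (Primrec.snd.pair (Primrec.snd.comp Primrec.fst))))).of_eq fun x => ?_
    constructor
    · rintro ⟨b, h1, h2⟩
      exact Part.mem_bind h1 h2
    · intro hx
      exact Part.mem_bind_iff.1 hx
  | @prec f h _ _ hf hh =>
    -- A primitive recursion is certified by the list of its intermediate values.
    have key : IsSigmaTwo fun y : (ℕ × ℕ) × ℕ × ℕ =>
        y.2.2 ∈ h (Nat.pair y.1.1 (Nat.pair y.1.2 y.2.1)) :=
      hh.comp (Primrec.pair (Primrec₂.natPair.comp (Primrec.fst.comp Primrec.fst)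
        (Primrec₂.natPair.comp (Primrec.snd.comp Primrec.fst) (Primrec.fst.comp Primrec.snd)))
        (Primrec.snd.comp Primrec.snd))
    refine ((IsSigmaTwo.chain hf key).comp ((u1.pair u2).pair Primrec.snd)).of_eq fun x => ?_
    obtain ⟨x, b⟩ := x
    exact exists_list_chain_iff (init := fun s => s ∈ f x.unpair.1)
      (step := fun j t s => s ∈ h (Nat.pair x.unpair.1 (Nat.pair j t)))
      (G := fun n s => s ∈ (n.rec (f x.unpair.1) fun y IH => do
          let i ← IH
          h (Nat.pair x.unpair.1 (Nat.pair y i)) : Part ℕ)) (fun s => Iff.rfl)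
      (fun j s => by simp) _ _
  | @rfind f _ hf =>
    -- The search returns `n` when `f` is `0` at `n` and is defined and nonzero, that is, a
    -- successor, at all smaller arguments.
    have h1 : IsSigmaTwo fun x : ℕ × ℕ => 0 ∈ f (Nat.pair x.1 x.2) :=
      hf.comp (Primrec.pair (Primrec₂.natPair.comp Primrec.fst Primrec.snd) (Primrec.const 0))
    have h2 : IsSigmaTwo fun y : (ℕ × ℕ) × ℕ => ∃ v, v + 1 ∈ f (Nat.pair y.1.1 y.2) :=
      IsSigmaTwo.ex (β := ℕ) (p := fun z : ((ℕ × ℕ) × ℕ) × ℕ =>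
        z.2 + 1 ∈ f (Nat.pair z.1.1.1 z.1.2)) (hf.comp (Primrec.pair (Primrec₂.natPair.comp
          (Primrec.fst.comp (Primrec.fst.comp Primrec.fst)) (Primrec.snd.comp Primrec.fst))
          (Primrec.succ.comp Primrec.snd)))
    refine (h1.and (h2.forall_lt Primrec.snd)).of_eq fun x => ?_
    refine Iff.trans ?_ Nat.mem_rfind.symm
    simp only [Part.map_eq_map, Part.mem_map_iff, decide_eq_true_eq,
      decide_eq_false_iff_not, exists_eq_right]
    refine and_congr Iff.rfl (forall₂_congr fun i _ => ?_)
    constructor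
    · rintro ⟨v, hv⟩
      exact ⟨v + 1, hv, by simp⟩
    · rintro ⟨v, hv, hv0⟩
      exact ⟨v - 1, by rwa [Nat.sub_add_cancel (Nat.pos_of_ne_zero hv0)]⟩

/-- The halting set is enumerable. -/
theorem exists_primrecPred_haltingSet :
    ∃ R : ℕ × ℕ → Prop, PrimrecPred R ∧ ∀ m, m ∈ haltingSet ↔ ∃ k, R (m, k) := by
  refine ⟨fun x => (Code.evaln x.2 (Denumerable.ofNat Code x.1.unpair.1)
    x.1.unpair.2).isSome = true, ?_, fun m => ?_⟩
  · have hu : Primrec fun x : ℕ × ℕ => x.1.unpair := Primrec.unpair.comp Primrec.fst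
    exact Primrec.eq.comp (Primrec.option_isSome.comp (Code.primrec_evaln.comp
      ((Primrec.snd.pair ((Primrec.ofNat Code).comp (Primrec.fst.comp hu))).pair
        (Primrec.snd.comp hu)))) (Primrec.const true)
  · simp only [haltingSet, Set.mem_ofPred_eq, Part.dom_iff_mem, Code.evaln_complete,
      Option.isSome_iff_exists, Option.mem_def]
    exact exists_comm

/-- The answer `1` is a `Σ₁` event and the answer `0` a `Π₁` event; both are `Σ₂`. -/
theorem isSigmaTwo_zeroJump_graph : IsSigmaTwo fun x : ℕ × ℕ => x.2 ∈ zeroJump x.1 := by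
  obtain ⟨R, hR, h⟩ := exists_primrecPred_haltingSet
  have h1 : IsSigmaTwo fun m => m ∈ haltingSet := (IsSigmaTwo.of_exists hR).of_eq
    fun m => (h m).symm
  have h2 : IsSigmaTwo fun m => m ∉ haltingSet := (IsSigmaTwo.of_forall hR.not).of_eq
    fun m => by rw [h, not_exists]
  refine (((h1.comp Primrec.fst).and (.of_primrec_eq Primrec.snd (Primrec.const 1))).or
    ((h2.comp Primrec.fst).and (.of_primrec_eq Primrec.snd (Primrec.const 0)))).of_eq
    fun x => ?_
  unfold zeroJump
  by_cases hx : x.1 ∈ haltingSet <;> simp [hx]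

/-- Post's theorem, first half: what is enumerable in the halting problem is `Σ₂`. -/
theorem REPredIn.isSigmaTwo {p : α → Prop} (hp : REPredIn zeroJump p) : IsSigmaTwo p := by
  have h := isSigmaTwo_graph_of_recursiveIn (O := {zeroJump})
    (fun g hg => by rw [Set.mem_singleton_iff.1 hg]; exact isSigmaTwo_zeroJump_graph) hp
  -- The only possible output is `()`, whose code is `0`, so lying in the domain means having the
  -- value `0`.
  refine (h.comp (Primrec.encode.pair (Primrec.const 0))).of_eq fun a => ?_
  simp only [encodek, Part.coe_some, Part.bind_some, Part.mem_map_iff, Part.mem_assert_iff]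
  exact ⟨fun ⟨_, h, _⟩ => h.1, fun h => ⟨(), ⟨h, Part.mem_some _⟩, rfl⟩⟩

theorem rfind_some_dom (f : ℕ → Bool) :
    (Nat.rfind fun m => Part.some (f m)).Dom ↔ ∃ m, f m = true :=
  Nat.rfind_dom.trans (exists_congr fun _ =>
    ⟨fun h => (Part.mem_some_iff.1 h.1).symm, fun h =>
      ⟨Part.mem_some_iff.2 h.symm, fun _ => trivial⟩⟩)

/-- Post's theorem, second half: what is `Σ₂` is enumerable in the halting problem. -/
theorem IsSigmaTwo.rePredIn {p : α → Prop} (hp : IsSigmaTwo p) : REPredIn zeroJump p := by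
  obtain ⟨R, hR, h⟩ := hp
  classical
  -- the program that searches for a counterexample to `∀ m, R (a, k, m)`
  let q : ℕ → ℕ → Prop := fun x m =>
    ∀ a, decode (α := α) x.unpair.1 = some a → ¬ R (a, x.unpair.2, m)
  have hq : PrimrecRel q := by
    have hc : Primrec fun y : ℕ × ℕ => (decode (α := α) y.1.unpair.1) :=
      Primrec.decode.comp (Primrec.fst.comp (Primrec.unpair.comp Primrec.fst))
    have hs : Primrec₂ fun (y : ℕ × ℕ) (a : α) => !decide (R (a, y.1.unpair.2, y.2)) :=
      Primrec.not.comp (hR.decide.comp (Primrec.snd.pair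
        ((Primrec.snd.comp (Primrec.unpair.comp (Primrec.fst.comp Primrec.fst))).pair
          (Primrec.snd.comp Primrec.fst))))
    have := Primrec.eq.comp (Primrec.option_casesOn hc (Primrec.const true) hs)
      (Primrec.const true)
    refine this.of_eq fun y => ?_
    cases e : decode (α := α) y.1.unpair.1 <;> simp [q, e]
  obtain ⟨e, he⟩ := Code.exists_code.1 (Partrec.nat_iff.1 (Partrec.rfind
    (p := fun x m => Part.some (decide (q x m))) hq.decide.to_comp.partrec))
  have hdom : ∀ x, Nat.pair (encode e) x ∈ haltingSet ↔ ∃ m, q x m := fun x => by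
    simpa [haltingSet, he] using rfind_some_dom fun m => decide (q x m)
  -- The oracle answers `0` exactly when the search for a counterexample to the witness `k`
  -- diverges, so searching for such a `k` halts if and only if `p a` holds. A number that codes no
  -- element satisfies `q` vacuously and is never accepted.
  have hg : Nat.RecursiveIn {zeroJump} fun x => zeroJump (Nat.pair (encode e) x) := by
    refine (Nat.RecursiveIn.comp (O := {zeroJump}) (.oracle zeroJump rfl)
      (Nat.Primrec.recursiveIn (Primrec.nat_iff.1
        (Primrec₂.natPair.comp (Primrec.const (encode e)) Primrec.id)))).of_eq fun n => ?_
    exact Part.bind_some _ _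
  refine (Nat.RecursiveIn.comp .zero hg.rfind).of_eq fun n => ?_
  have hr : (Nat.rfind fun k => (fun m => decide (m = 0)) <$>
      (zeroJump (Nat.pair (encode e) (Nat.pair n k)) : Part ℕ)).Dom ↔
      ∃ a, decode (α := α) n = some a ∧ p a := by
    have hz : (fun k => (fun m => decide (m = 0)) <$>
        (zeroJump (Nat.pair (encode e) (Nat.pair n k)) : Part ℕ)) = fun k =>
        Part.some (decide (Nat.pair (encode e) (Nat.pair n k) ∉ haltingSet)) := by
      funext k
      unfold zeroJump
      by_cases hk : Nat.pair (encode e) (Nat.pair n k) ∈ haltingSet <;> simp [hk]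
    rw [hz, rfind_some_dom]
    have : ∀ k, Nat.pair (encode e) (Nat.pair n k) ∉ haltingSet ↔
        ∃ a, decode (α := α) n = some a ∧ ∀ m, R (a, k, m) := by
      intro k
      simp only [hdom, q, Nat.unpair_pair]
      cases decode (α := α) n <;> simp
    simp only [decide_eq_true_eq, this, h]
    exact ⟨fun ⟨k, a, h1, h2⟩ => ⟨a, h1, k, h2⟩, fun ⟨a, h1, k, h2⟩ => ⟨k, a, h1, h2⟩⟩
  refine Part.ext fun b => ?_
  have hl : ∀ x : Part ℕ, b ∈ (x >>= fun _ => (0 : Part ℕ)) ↔ x.Dom ∧ b = 0 := fun x => by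
    rw [Part.bind_eq_bind, Part.mem_bind_iff, Part.dom_iff_mem]
    exact ⟨fun ⟨c, hc, hb⟩ => ⟨⟨c, hc⟩, Part.mem_some_iff.1 hb⟩,
      fun ⟨⟨c, hc⟩, hb⟩ => ⟨c, hc, Part.mem_some_iff.2 hb⟩⟩
  refine (hl _).trans ((and_congr_left' hr).trans ?_)
  cases decode (α := α) n with
  | none => simp
  | some a =>
    simp only [Part.coe_some, Part.bind_some, Part.mem_map_iff, Part.mem_assert_iff]
    constructor
    · rintro ⟨⟨_, h, ha⟩, rfl⟩
      cases h
      exact ⟨(), ⟨ha, Part.mem_some _⟩, rfl⟩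
    · rintro ⟨_, ⟨ha, _⟩, rfl⟩
      exact ⟨⟨a, rfl, ha⟩, rfl⟩

end

/-! ### Binary strings of given length -/

/-- The list of all binary strings of length `n`. -/
def boolStrings : ℕ → List (List Bool)
  | 0 => [[]]
  | n + 1 => (boolStrings n).flatMap fun l => [false :: l, true :: l]

@[simp]
theorem mem_boolStrings {n : ℕ} {y : List Bool} : y ∈ boolStrings n ↔ y.length = n := by
  induction n generalizing y with
  | zero => simp [boolStrings]
  | succ n ih =>
    cases y with
    | nil => simp [boolStrings]
    | cons b l => cases b <;> simp [boolStrings, ih]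

theorem length_boolStrings (n : ℕ) : (boolStrings n).length = 2 ^ n := by
  induction n with
  | zero => rfl
  | succ n ih => simp [boolStrings, List.length_flatMap, ih, pow_succ]

theorem nodup_boolStrings (n : ℕ) : (boolStrings n).Nodup := by
  induction n with
  | zero => simp [boolStrings]
  | succ n ih =>
    rw [boolStrings, List.nodup_flatMap]
    refine ⟨fun l _ => by simp, ih.imp fun {a b} hab => ?_⟩
    simp only [Function.onFun]
    intro x hx hx'
    grind

theorem primrec_boolStrings : Primrec boolStrings := by
  have h : Primrec fun n : ℕ => (n.rec [[]] fun _ L =>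
      L.flatMap fun l => [false :: l, true :: l] : List (List Bool)) := by
    refine Primrec.nat_rec₁ _ ?_
    have hc : ∀ b : Bool, Primrec fun p : (ℕ × List (List Bool)) × List Bool => b :: p.2 :=
      fun b => Primrec.list_cons.comp (Primrec.const b) Primrec.snd
    exact Primrec.list_flatMap Primrec.snd (Primrec.list_cons.comp (hc false)
      (Primrec.list_cons.comp (hc true) (Primrec.const [])))
  refine h.of_eq fun n => ?_
  induction n with
  | zero => rfl
  | succ n ih => rw [boolStrings, ← ih]

/-! ### The measure of open sets of sequences -/

@[simp]
theorem length_initSeg (ω : ℕ → Bool) (n : ℕ) : (initSeg ω n).length = n := by simp [initSeg]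

theorem initSeg_prefix (ω : ℕ → Bool) {m n : ℕ} (h : m ≤ n) : initSeg ω m <+: initSeg ω n := by
  rw [List.prefix_iff_eq_take]
  simp [initSeg, ← List.map_take, List.take_range, h]

theorem initSeg_mem_cantorInterval {ω : ℕ → Bool} {x : List Bool} :
    ω ∈ cantorInterval x ↔ initSeg ω x.length = x := Iff.rfl

theorem mem_openOf {ω : ℕ → Bool} {S : Set (List Bool)} :
    ω ∈ openOf S ↔ ∃ n, initSeg ω n ∈ S := by
  simp only [openOf, Set.mem_iUnion, exists_prop, initSeg_mem_cantorInterval]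
  constructor
  · rintro ⟨x, hx, h⟩
    exact ⟨x.length, by rwa [h]⟩
  · rintro ⟨n, hn⟩
    exact ⟨_, hn, by simp⟩

theorem cantorInterval_eq_pi (x : List Bool) :
    cantorInterval x = Set.pi (Finset.range x.length : Finset ℕ)
      fun i => ({x.getD i false} : Set Bool) := by
  ext ω
  rw [initSeg_mem_cantorInterval, List.ext_getElem_iff]
  simp [initSeg, Set.mem_pi, List.getD]
  refine forall_congr' fun i => ?_
  constructor
  · intro h hi
    simpa [hi] using h hi
  · intro h hi
    simpa [hi] using h hi

theorem measurableSet_cantorInterval (x : List Bool) : MeasurableSet (cantorInterval x) := by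
  rw [cantorInterval_eq_pi]
  exact MeasurableSet.pi (Finset.countable_toSet _) fun _ _ => measurableSet_singleton _

theorem coinMeasure_cantorInterval (x : List Bool) :
    coinMeasure (cantorInterval x) = 2⁻¹ ^ x.length := by
  rw [cantorInterval_eq_pi, coinMeasure, Measure.infinitePi_pi]
  · simp
  · exact fun _ _ => measurableSet_singleton _

theorem coinMeasure_openOf_finset {n : ℕ} (T : Finset (List Bool)) (hT : ∀ y ∈ T, y.length = n) :
    coinMeasure (openOf T) = T.card * 2⁻¹ ^ n := by
  have hd : Set.PairwiseDisjoint (T : Set (List Bool)) cantorInterval := by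
    intro x hx y hy hxy
    refine Set.disjoint_left.2 fun ω h1 h2 => hxy ?_
    rw [← initSeg_mem_cantorInterval.1 h1, ← initSeg_mem_cantorInterval.1 h2, hT x hx, hT y hy]
  have := measure_biUnion_finset (μ := coinMeasure) hd fun x _ => measurableSet_cantorInterval x
  simp only [openOf, Finset.mem_coe]
  rw [this, Finset.sum_congr rfl fun x hx => by rw [coinMeasure_cantorInterval, hT x hx]]
  simp

open scoped Classical in
/-- The strings of length `n` that extend a string in `S`. -/
noncomputable def levelExt (S : Set (List Bool)) (n : ℕ) : Finset (List Bool) :=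
  (boolStrings n).toFinset.filter fun y => ∃ x ∈ S, x <+: y

theorem mem_levelExt {S : Set (List Bool)} {n : ℕ} {y : List Bool} :
    y ∈ levelExt S n ↔ y.length = n ∧ ∃ x ∈ S, x <+: y := by
  simp [levelExt]

/-- This turns measure bounds into inequalities of natural numbers, which can be checked by
primitive recursion. -/
theorem card_mul_inv_pow_le_iff (a n c : ℕ) :
    (a : ENNReal) * 2⁻¹ ^ n ≤ 2⁻¹ ^ c ↔ a * 2 ^ c ≤ 2 ^ n := by
  have h0 : ∀ k : ℕ, (2 : ENNReal) ^ k ≠ 0 := fun k => by simp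
  have ht : ∀ k : ℕ, (2 : ENNReal) ^ k ≠ ⊤ := fun k => by simp
  rw [← ENNReal.inv_pow, ← ENNReal.inv_pow, ← div_eq_mul_inv,
    ENNReal.div_le_iff (h0 n) (ht n), mul_comm _ ((2 : ENNReal) ^ n), ← div_eq_mul_inv,
    ENNReal.le_div_iff_mul_le (.inl (h0 c)) (.inl (ht c))]
  norm_cast

theorem card_levelExt_le {S : Set (List Bool)} {c : ℕ} (hS : coinMeasure (openOf S) ≤ 2⁻¹ ^ c)
    (n : ℕ) : (levelExt S n).card * 2 ^ c ≤ 2 ^ n := by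
  rw [← card_mul_inv_pow_le_iff, ← coinMeasure_openOf_finset _ fun y hy => (mem_levelExt.1 hy).1]
  refine (measure_mono fun ω hω => ?_).trans hS
  obtain ⟨m, hm⟩ := mem_openOf.1 hω
  obtain ⟨-, x, hx, hxm⟩ := mem_levelExt.1 hm
  refine mem_openOf.2 ⟨x.length, ?_⟩
  have hle : x.length ≤ m := by simpa using hxm.length_le
  rwa [List.prefix_of_prefix_length_le hxm (initSeg_prefix ω hle) (by simp) |>.eq_of_length
    (by simp)] at hx

/-- The open set is the increasing union of the sets generated by its finite levels, so its measure
is the supremum of theirs. -/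
theorem coinMeasure_openOf_le {S : Set (List Bool)} {c : ℕ}
    (hS : ∀ n, (levelExt S n).card * 2 ^ c ≤ 2 ^ n) : coinMeasure (openOf S) ≤ 2⁻¹ ^ c := by
  have hU : openOf S = ⋃ n, openOf (levelExt S n : Set (List Bool)) := by
    ext ω
    rw [Set.mem_iUnion, mem_openOf]
    constructor
    · rintro ⟨n, hn⟩
      exact ⟨n, mem_openOf.2 ⟨n, by simpa [mem_levelExt] using ⟨_, hn, List.prefix_refl _⟩⟩⟩
    · rintro ⟨n, hn⟩
      obtain ⟨m, hm⟩ := mem_openOf.1 hn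
      obtain ⟨-, x, hx, hxm⟩ := mem_levelExt.1 hm
      refine ⟨x.length, ?_⟩
      have hle : x.length ≤ m := by simpa using hxm.length_le
      rwa [List.prefix_of_prefix_length_le hxm (initSeg_prefix ω hle) (by simp) |>.eq_of_length
        (by simp)] at hx
  have hmono : Monotone fun n => openOf (levelExt S n : Set (List Bool)) := by
    intro m n hmn ω hω
    obtain ⟨k, hk⟩ := mem_openOf.1 hω
    obtain ⟨h1, x, hx, hxk⟩ := mem_levelExt.1 hk
    rw [length_initSeg] at h1
    subst h1
    exact mem_openOf.2 ⟨n, mem_levelExt.2 ⟨by simp, x, hx, hxk.trans (initSeg_prefix ω hmn)⟩⟩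
  rw [hU, hmono.measure_iUnion]
  refine iSup_le fun n => ?_
  rw [coinMeasure_openOf_finset _ fun y hy => (mem_levelExt.1 hy).1, card_mul_inv_pow_le_iff]
  exact hS n

/-! ### Primitive recursive operations on strings and lists -/

theorem primrecPred_prefix {α : Type*} [Primcodable α] {f g : α → List Bool} (hf : Primrec f)
    (hg : Primrec g) : PrimrecPred fun a => f a <+: g a :=
  (Primrec.eq.comp hf (Primrec.list_take.comp (Primrec.list_length.comp hf) hg)).of_eq
    fun _ => List.prefix_iff_eq_take.symm

theorem primrecPred_exists_mem {α β : Type*} [Primcodable α] [Primcodable β] {f : α → List β}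
    (hf : Primrec f) {p : β × α → Prop} (hp : PrimrecPred p) :
    PrimrecPred fun a => ∃ b ∈ f a, p (b, a) :=
  (PrimrecRel.exists_mem_list (R := fun b a => p (b, a)) hp).comp hf Primrec.id

theorem primrec_filter {α β : Type*} [Primcodable α] [Primcodable β] {f : α → List β}
    (hf : Primrec f) {p : β × α → Prop} {d : ∀ a, DecidablePred fun b => p (b, a)}
    (hp : PrimrecPred p) : Primrec fun a => (f a).filter fun b => p (b, a) := by
  classical
  exact ((PrimrecRel.listFilter (R := fun b a => p (b, a)) hp).comp hf Primrec.id).of_eq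
    fun a => List.filter_congr fun b _ => by simp

/-- The string with code `j`. -/
def codedString (j : ℕ) : List Bool := (decode j).getD []

@[simp]
theorem codedString_encode (x : List Bool) : codedString (encode x) = x := by
  simp [codedString]

theorem primrec_codedString : Primrec codedString :=
  Primrec.option_getD.comp Primrec.decode (Primrec.const [])

theorem primrec_two_pow : Primrec fun n : ℕ => 2 ^ n := by
  have h : Primrec fun n : ℕ => (n.rec 1 fun _ x => x + x : ℕ) :=
    Primrec.nat_rec₁ _ (Primrec.nat_add.comp Primrec.snd Primrec.snd)
  refine h.of_eq fun n => ?_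
  induction n with
  | zero => rfl
  | succ n ih => rw [pow_succ, ← ih]; simp; omega

/-! ### Covering limits of enumerable sets of strings -/

namespace GreedyCover

/-- The strings of length `n` that extend an element of `L` or lie in `U`. -/
noncomputable def covered (U : Set (List Bool)) (L : List (List Bool)) (n : ℕ) :
    Finset (List Bool) := by
  classical
  exact (boolStrings n).toFinset.filter fun y => (∃ x ∈ L, x <+: y) ∨ y ∈ U

theorem mem_covered {U : Set (List Bool)} {L : List (List Bool)} {n : ℕ} {y : List Bool} :
    y ∈ covered U L n ↔ y.length = n ∧ ((∃ x ∈ L, x <+: y) ∨ y ∈ U) := by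
  simp [covered]

/-- At every length, the covered strings have density at most `2 ^ (-c)`. -/
def Small (U : Set (List Bool)) (c : ℕ) (L : List (List Bool)) : Prop :=
  ∀ n, (covered U L n).card * 2 ^ c ≤ 2 ^ n

open scoped Classical in
/-- The strings among the first `j` that are accepted by the greedy procedure, which accepts a
string if the cover stays small. -/
noncomputable def accepted (U : Set (List Bool)) (c : ℕ) : ℕ → List (List Bool)
  | 0 => []
  | j + 1 =>
    if Small U c (codedString j :: accepted U c j) then
      codedString j :: accepted U c j
    else accepted U c j

variable {U : Set (List Bool)} {c : ℕ}

theorem accepted_subset_succ (j : ℕ) : accepted U c j ⊆ accepted U c (j + 1) := by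
  rw [accepted]
  split_ifs
  · exact List.subset_cons_self _ _
  · exact List.Subset.refl _

theorem accepted_subset {i j : ℕ} (h : i ≤ j) : accepted U c i ⊆ accepted U c j := by
  induction j, h using Nat.le_induction with
  | base => exact List.Subset.refl _
  | succ j _ ih => exact fun _ hx => accepted_subset_succ j (ih hx)

theorem small_accepted (h : Small U c []) (j : ℕ) : Small U c (accepted U c j) := by
  induction j with
  | zero => exact h
  | succ j ih =>
    rw [accepted]
    split_ifs with hs
    · exact hs
    · exact ih

/-- All extensions of `x` are already counted through `U`, so accepting `x` covers nothing new, and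
`x` passes when its turn `encode x` comes. -/
theorem mem_accepted (h : Small U c []) {x : List Bool} (hx : ∀ y, x <+: y → y ∈ U) :
    ∃ j, x ∈ accepted U c j := by
  refine ⟨encode x + 1, ?_⟩
  rw [accepted, codedString_encode, if_pos]
  · exact List.mem_cons_self
  · intro n
    refine le_trans (Nat.mul_le_mul_right _ (Finset.card_le_card fun y hy => ?_))
      (small_accepted h (encode x) n)
    rw [mem_covered] at hy ⊢
    refine ⟨hy.1, ?_⟩
    rcases hy.2 with ⟨z, hz, hzy⟩ | hU
    · rcases List.mem_cons.1 hz with rfl | hz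
      · exact .inr (hx y hzy)
      · exact .inl ⟨z, hz, hzy⟩
    · exact .inr hU

/-- A level contains finitely many strings, so all those ever covered by accepted strings are
covered at one finite stage, where smallness is known. -/
theorem measure_accepted (h : Small U c []) :
    coinMeasure (openOf {x | ∃ j, x ∈ accepted U c j}) ≤ 2⁻¹ ^ c := by
  refine coinMeasure_openOf_le fun n => ?_
  have hy : ∀ y ∈ levelExt {x | ∃ j, x ∈ accepted U c j} n,
      ∃ j, ∃ x ∈ accepted U c j, x <+: y := by
    intro y hy
    obtain ⟨-, x, ⟨j, hj⟩, hxy⟩ := mem_levelExt.1 hy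
    exact ⟨j, x, hj, hxy⟩
  choose! g hg using hy
  refine le_trans (Nat.mul_le_mul_right _ (Finset.card_le_card fun y hy => ?_))
    (small_accepted h ((levelExt {x | ∃ j, x ∈ accepted U c j} n).sup g) n)
  obtain ⟨x, hx, hxy⟩ := hg y hy
  exact mem_covered.2 ⟨(mem_levelExt.1 hy).1,
    .inl ⟨x, accepted_subset (Finset.le_sup (f := g) hy) hx, hxy⟩⟩

/-- An overfull level is a finite event: by monotonicity, one common time `t` suffices for all its
strings. -/
theorem not_small_iff {Q : List Bool → ℕ → Prop} (hQ : ∀ y s t, s ≤ t → Q y s → Q y t)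
    [∀ (L : List (List Bool)) t, DecidablePred fun y => (∃ x ∈ L, x <+: y) ∨ Q y t]
    {L : List (List Bool)} : ¬ Small {y | ∃ t, Q y t} c L ↔ ∃ n t, 2 ^ n <
      ((boolStrings n).filter fun y => (∃ x ∈ L, x <+: y) ∨ Q y t).length * 2 ^ c := by
  have hlen : ∀ n t, ((boolStrings n).filter fun y => (∃ x ∈ L, x <+: y) ∨ Q y t).length =
      (((boolStrings n).filter fun y => (∃ x ∈ L, x <+: y) ∨ Q y t).toFinset).card :=
    fun n t => (List.toFinset_card_of_nodup ((nodup_boolStrings n).filter _)).symm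
  simp only [Small, not_forall, not_le, hlen]
  refine exists_congr fun n => ⟨fun h => ?_, fun ⟨t, h⟩ => ?_⟩
  · have hy : ∀ y, (∃ t, Q y t) → ∃ t, Q y t := fun y hy => hy
    choose! g hg using hy
    refine ⟨(boolStrings n).toFinset.sup g, h.trans_le (Nat.mul_le_mul_right _
      (Finset.card_le_card fun y hy => ?_))⟩
    obtain ⟨h1, h2⟩ := mem_covered.1 hy
    simp only [List.toFinset_filter, decide_eq_true_eq, Finset.mem_filter, List.mem_toFinset,
      mem_boolStrings]
    exact ⟨h1, h2.imp_right fun h => hQ _ _ _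
      (Finset.le_sup (f := g) (by simpa using h1)) (hg y h)⟩
  · refine h.trans_le (Nat.mul_le_mul_right _ (Finset.card_le_card fun y hy => ?_))
    simp only [List.toFinset_filter, decide_eq_true_eq, Finset.mem_filter, List.mem_toFinset,
      mem_boolStrings] at hy
    exact mem_covered.2 ⟨hy.1, hy.2.imp_right fun h => ⟨t, h⟩⟩

/-- Smallness of the cover is the negation of an enumerable condition. -/
theorem exists_primrecPred_small {Q : ℕ × List Bool × ℕ → Prop} (hQ : PrimrecPred Q)
    (hmono : ∀ c y s t, s ≤ t → Q (c, y, s) → Q (c, y, t)) :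
    ∃ B : (ℕ × List (List Bool)) × ℕ → Prop, PrimrecPred B ∧
      ∀ c L, Small {y | ∃ t, Q (c, y, t)} c L ↔ ∀ k, ¬ B ((c, L), k) := by
  classical
  have hu : Primrec fun z : (ℕ × List (List Bool)) × ℕ => z.2.unpair :=
    Primrec.unpair.comp Primrec.snd
  have hu' : Primrec fun z : List Bool × (ℕ × List (List Bool)) × ℕ => z.2.2.unpair :=
    hu.comp Primrec.snd
  refine ⟨fun z => 2 ^ z.2.unpair.1 < ((boolStrings z.2.unpair.1).filter fun y =>
    (∃ x ∈ z.1.2, x <+: y) ∨ Q (z.1.1, y, z.2.unpair.2)).length * 2 ^ z.1.1, ?_, fun c L => ?_⟩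
  · have hL : Primrec fun z : List Bool × (ℕ × List (List Bool)) × ℕ => z.2.1.2 :=
      Primrec.snd.comp (Primrec.fst.comp Primrec.snd)
    have h1 : PrimrecPred fun z : List Bool × (ℕ × List (List Bool)) × ℕ =>
        ∃ x ∈ z.2.1.2, x <+: z.1 :=
      primrecPred_exists_mem hL (p := fun w => w.1 <+: w.2.1)
        (primrecPred_prefix Primrec.fst (Primrec.fst.comp Primrec.snd))
    have h2 : PrimrecPred fun z : List Bool × (ℕ × List (List Bool)) × ℕ =>
        Q (z.2.1.1, z.1, z.2.2.unpair.2) :=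
      hQ.comp ((Primrec.fst.comp (Primrec.fst.comp Primrec.snd)).pair
        (Primrec.fst.pair (Primrec.snd.comp hu')))
    exact Primrec.nat_lt.comp (primrec_two_pow.comp (Primrec.fst.comp hu))
      (Primrec.nat_mul.comp (Primrec.list_length.comp (primrec_filter
        (primrec_boolStrings.comp (Primrec.fst.comp hu)) (h1.or h2)))
        (primrec_two_pow.comp (Primrec.fst.comp Primrec.fst)))
  · rw [← not_iff_not, not_small_iff (Q := fun y t => Q (c, y, t)) (hmono c)]
    simp only [not_forall, not_not]
    constructor
    · rintro ⟨n, t, h⟩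
      exact ⟨Nat.pair n t, by simpa using h⟩
    · rintro ⟨k, h⟩
      exact ⟨_, _, h⟩

/-- Smallness is `Π₁` and its failure `Σ₁`, so both branches of a greedy step are `Σ₂`; the run of
the procedure is then a chain of such steps on coded lists. -/
theorem isSigmaTwo_mem_accepted {Q : ℕ × List Bool × ℕ → Prop} (hQ : PrimrecPred Q)
    (hmono : ∀ c y s t, s ≤ t → Q (c, y, s) → Q (c, y, t)) :
    IsSigmaTwo fun a : ℕ × List Bool =>
      ∃ j, a.2 ∈ accepted {y | ∃ t, Q (a.1, y, t)} a.1 j := by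
  obtain ⟨B, hB, hsmall⟩ := exists_primrecPred_small hQ hmono
  have hdec : Primrec fun s : ℕ => (decode (α := List (List Bool)) s).getD [] :=
    Primrec.option_getD.comp Primrec.decode (Primrec.const [])
  let step : (ℕ × ℕ) × ℕ × ℕ → Prop := fun x =>
    (Small {y | ∃ t, Q (x.1.1, y, t)} x.1.1 (codedString x.1.2 ::
        (decode (α := List (List Bool)) x.2.1).getD []) ∧
      x.2.2 = encode (codedString x.1.2 ::
        (decode (α := List (List Bool)) x.2.1).getD [])) ∨
    (¬ Small {y | ∃ t, Q (x.1.1, y, t)} x.1.1 (codedString x.1.2 ::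
        (decode (α := List (List Bool)) x.2.1).getD []) ∧
      x.2.2 = encode ((decode (α := List (List Bool)) x.2.1).getD []))
  have hstep : IsSigmaTwo step := by
    have hL : Primrec fun x : (ℕ × ℕ) × ℕ × ℕ =>
        (decode (α := List (List Bool)) x.2.1).getD [] :=
      hdec.comp (Primrec.fst.comp Primrec.snd)
    have hxL : Primrec fun x : (ℕ × ℕ) × ℕ × ℕ => codedString x.1.2 ::
        (decode (α := List (List Bool)) x.2.1).getD [] :=
      Primrec.list_cons.comp
        (primrec_codedString.comp (Primrec.snd.comp Primrec.fst)) hL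
    have hc : Primrec fun x : (ℕ × ℕ) × ℕ × ℕ => (x.1.1, codedString x.1.2 ::
        (decode (α := List (List Bool)) x.2.1).getD []) :=
      (Primrec.fst.comp Primrec.fst).pair hxL
    have hs : Primrec fun x : (ℕ × ℕ) × ℕ × ℕ => x.2.2 := Primrec.snd.comp Primrec.snd
    refine .or (.and ?_ (.of_primrec_eq hs (Primrec.encode.comp hxL)))
      (.and ?_ (.of_primrec_eq hs (Primrec.encode.comp hL)))
    · refine (IsSigmaTwo.comp (p := fun a : ℕ × List (List Bool) => ∀ k, ¬ B (a, k))
        (.of_forall hB.not) hc).of_eq fun x => ?_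
      rw [hsmall]
    · refine (IsSigmaTwo.comp (p := fun a : ℕ × List (List Bool) => ∃ k, B (a, k))
        (.of_exists hB) hc).of_eq fun x => ?_
      rw [hsmall]
      simp
  have hinit : IsSigmaTwo fun x : ℕ × ℕ => x.2 = encode ([] : List (List Bool)) :=
    .of_primrec_eq Primrec.snd (Primrec.const _)
  have hgraph : IsSigmaTwo fun x : (ℕ × ℕ) × ℕ =>
      x.2 = encode (accepted {y | ∃ t, Q (x.1.1, y, t)} x.1.1 x.1.2) := by
    refine (IsSigmaTwo.chain hinit hstep).of_eq fun x => ?_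
    obtain ⟨⟨c, n⟩, s⟩ := x
    refine exists_list_chain_iff (init := fun s => s = encode ([] : List (List Bool)))
      (step := fun j t s => step ((c, j), t, s))
      (G := fun j s => s = encode (accepted {y | ∃ t, Q (c, y, t)} c j))
      (fun s => Iff.rfl) (fun j s => ?_) n s
    simp only [exists_eq_left, step, encodek, Option.getD_some]
    rw [accepted]
    split_ifs with h <;> simp [h]
  have hmem : IsSigmaTwo fun z : (ℕ × List Bool) × ℕ × ℕ =>
      z.1.2 ∈ (decode (α := List (List Bool)) z.2.2).getD [] := by
    refine .of_primrecPred ((primrecPred_exists_mem (f := fun z : (ℕ × List Bool) × ℕ × ℕ =>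
      (decode (α := List (List Bool)) z.2.2).getD []) (p := fun w => w.1 = w.2.1.2)
      (hdec.comp (Primrec.snd.comp Primrec.snd)) (Primrec.eq.comp Primrec.fst
        (Primrec.snd.comp (Primrec.fst.comp Primrec.snd)))).of_eq fun z => by simp)
  refine (IsSigmaTwo.ex ((hgraph.comp (((Primrec.fst.comp Primrec.fst).pair
    (Primrec.fst.comp Primrec.snd)).pair (Primrec.snd.comp Primrec.snd))).and hmem)).of_eq
    fun a => ?_
  simp

end GreedyCover

/-- If, at every level `c`, the enumerable set of strings `{y | ∃ t, Q (c, y, t)}` has density at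
most `2 ^ (-c)` at every length, then some Martin-Löf test relative to the halting problem covers
every string all of whose extensions lie in that set. -/
theorem exists_isMLTest_of_density {Q : ℕ × List Bool × ℕ → Prop} (hQ : PrimrecPred Q)
    (hmono : ∀ c y s t, s ≤ t → Q (c, y, s) → Q (c, y, t))
    (hcard : ∀ c n, ∀ T : Finset (List Bool), (∀ y ∈ T, y.length = n ∧ ∃ t, Q (c, y, t)) →
      T.card * 2 ^ c ≤ 2 ^ n) :
    ∃ V, IsMLTest zeroJump V ∧ ∀ c x, (∀ y, x <+: y → ∃ t, Q (c, y, t)) → x ∈ V c := by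
  have hs : ∀ c, GreedyCover.Small {y | ∃ t, Q (c, y, t)} c [] := fun c n =>
    hcard c n _ fun y hy => by simpa [GreedyCover.mem_covered] using hy
  exact ⟨fun c => {x | ∃ j, x ∈ GreedyCover.accepted {y | ∃ t, Q (c, y, t)} c j},
    ⟨(GreedyCover.isSigmaTwo_mem_accepted hQ hmono).rePredIn,
      fun c => GreedyCover.measure_accepted (hs c)⟩,
    fun c x hx => GreedyCover.mem_accepted (hs c) hx⟩

/-! ### Compressible strings -/

/-- The list of all binary strings of length less than `m`. -/
def shortStrings (m : ℕ) : List (List Bool) := (List.range m).flatMap boolStrings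

theorem mem_shortStrings {m : ℕ} {p : List Bool} : p ∈ shortStrings m ↔ p.length < m := by
  simp [shortStrings]

theorem length_shortStrings_lt (m : ℕ) : (shortStrings m).length < 2 ^ m := by
  induction m with
  | zero => simp [shortStrings]
  | succ m ih =>
    have : shortStrings (m + 1) = shortStrings m ++ boolStrings m := by
      simp [shortStrings, List.range_succ]
    rw [this, List.length_append, length_boolStrings, pow_succ]
    omega

theorem primrec_shortStrings : Primrec shortStrings :=
  Primrec.list_flatMap Primrec.list_range (primrec_boolStrings.comp Primrec.snd)

/-- There are fewer than `2 ^ (n - c)` programs of length less than `n - c`, so the strings of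
length `n` that they describe have density at most `2 ^ (-c)`. -/
theorem exists_isMLTest_of_compressible {D : List Bool →. List Bool} (hD : Partrec D) :
    ∃ V, IsMLTest zeroJump V ∧ ∀ c x,
      (∀ y, x <+: y → ∃ p, p.length + c < y.length ∧ y ∈ D p) → x ∈ V c := by
  obtain ⟨e, he⟩ := Nat.Partrec.Code.exists_code.1 hD
  have hmem : ∀ y p, y ∈ D p ↔
      ∃ t, Nat.Partrec.Code.evaln t e (encode p) = some (encode y) := by
    intro y p
    have h1 : encode y ∈ e.eval (encode p) ↔ y ∈ D p := by simp [he]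
    rw [← h1, Nat.Partrec.Code.evaln_complete]
    simp
  -- For `y` of length at most `c` the truncated difference is `0` and the list of programs is
  -- empty, as it should be.
  let Q : ℕ × List Bool × ℕ → Prop := fun z => ∃ p ∈ shortStrings (z.2.1.length - z.1),
    Nat.Partrec.Code.evaln z.2.2 e (encode p) = some (encode z.2.1)
  have hex : ∀ c y, (∃ t, Q (c, y, t)) ↔ ∃ p, p.length + c < y.length ∧ y ∈ D p := by
    intro c y
    simp only [Q, mem_shortStrings, hmem, Nat.lt_sub_iff_add_lt]
    exact ⟨fun ⟨t, p, h1, h2⟩ => ⟨p, h1, t, h2⟩, fun ⟨p, h1, t, h2⟩ => ⟨t, p, h1, h2⟩⟩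
  have hQ : PrimrecPred Q := by
    have hy : Primrec fun w : List Bool × ℕ × List Bool × ℕ => w.2.2 :=
      Primrec.snd.comp Primrec.snd
    refine primrecPred_exists_mem (p := fun w => Nat.Partrec.Code.evaln w.2.2.2 e (encode w.1) =
      some (encode w.2.2.1)) (primrec_shortStrings.comp (Primrec.nat_sub.comp
        (Primrec.list_length.comp (Primrec.fst.comp Primrec.snd)) Primrec.fst)) ?_
    exact Primrec.eq.comp (Nat.Partrec.Code.primrec_evaln.comp
      (((Primrec.snd.comp hy).pair (Primrec.const e)).pair (Primrec.encode.comp Primrec.fst)))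
      (Primrec.option_some.comp (Primrec.encode.comp (Primrec.fst.comp hy)))
  have hmono : ∀ c y s t, s ≤ t → Q (c, y, s) → Q (c, y, t) :=
    fun c y s t hst ⟨p, hp, hs⟩ => ⟨p, hp, Nat.Partrec.Code.evaln_mono hst hs⟩
  have hcard : ∀ c n, ∀ T : Finset (List Bool), (∀ y ∈ T, y.length = n ∧ ∃ t, Q (c, y, t)) →
      T.card * 2 ^ c ≤ 2 ^ n := by
    intro c n T hT
    have hT' : ∀ y ∈ T, ∃ p, p.length + c < n ∧ y ∈ D p := fun y hy => by
      obtain ⟨rfl, h⟩ := hT y hy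
      exact (hex c y).1 h
    choose! f hf using hT'
    have hle : T.card ≤ (shortStrings (n - c)).length :=
      (Finset.card_le_card_of_injOn (t := (shortStrings (n - c)).toFinset) f
        (fun y hy => by simpa [mem_shortStrings, Nat.lt_sub_iff_add_lt] using (hf y hy).1)
        fun y hy z hz hyz => by
          have h1 := (hf y hy).2
          rw [hyz] at h1
          exact Part.mem_unique h1 (hf z hz).2).trans (List.toFinset_card_le _)
    rcases le_or_gt c n with hcn | hcn
    · have := hle.trans (length_shortStrings_lt _).le
      calc T.card * 2 ^ c ≤ 2 ^ (n - c) * 2 ^ c := Nat.mul_le_mul_right _ this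
        _ = 2 ^ n := by rw [← pow_add, Nat.sub_add_cancel hcn]
    · rw [Nat.sub_eq_zero_of_le hcn.le] at hle
      have : T.card = 0 := by simpa [shortStrings] using hle
      simp [this]
  obtain ⟨V, hV, h⟩ := exists_isMLTest_of_density hQ hmono hcard
  exact ⟨V, hV, fun c x hx => h c x fun y hy => (hex c y).2 (hx y hy)⟩

theorem exists_program {D : List Bool →. List Bool} {x : List Bool}
    (hx : plainComplexity D x ≠ ⊤) : ∃ p, x ∈ D p ∧ p.length = (plainComplexity D x).toNat := by
  by_contra! hcon
  obtain ⟨m, hm⟩ := ENat.ne_top_iff_exists.1 hx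
  have hle : ((m + 1 : ℕ) : ℕ∞) ≤ plainComplexity D x := by
    refine le_iInf₂ fun p hp => ?_
    have h1 := plainComplexity_le hp
    have h2 := hcon p hp
    rw [← hm] at h1 h2
    simp only [ENat.toNat_natCast, Nat.cast_le] at h1 h2 ⊢
    omega
  rw [← hm] at hle
  norm_cast at hle
  omega

theorem IsOptimalMethod.extDeficiency_le {D : List Bool →. List Bool} (hD : IsOptimalMethod D)
    {x y : List Bool} (h : x <+: y) : extDeficiency D x ≤ deficiency D y :=
  (hD.isGLB x).1 ⟨y, h, rfl⟩

theorem IsMLRandom.exists_extDeficiency_le {D : List Bool →. List Bool} (hD : IsOptimalMethod D)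
    {ω : ℕ → Bool} (hω : IsMLRandom zeroJump ω) :
    ∃ c : ℤ, ∀ n, extDeficiency D (initSeg ω n) ≤ c := by
  obtain ⟨V, hV, h⟩ := exists_isMLTest_of_compressible hD.1
  obtain ⟨c, hc⟩ := hω V hV
  refine ⟨c, fun n => ?_⟩
  by_contra! hn
  refine hc (mem_openOf.2 ⟨n, h c _ fun y hy => ?_⟩)
  obtain ⟨p, hp, hl⟩ := exists_program (hD.ne_top y)
  have := hD.extDeficiency_le hy
  unfold deficiency at this
  exact ⟨p, by omega, hp⟩

/-! ### Compressing all long extensions of the strings in a `Σ₂` test -/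

namespace StagedTest

variable (R : (ℕ × List Bool) × ℕ × ℕ → Prop)

/-- At stage `n`, the number `j`, which codes a string and a witness, has not been refuted as
evidence that the string lies in the `c`-th set of the test. -/
def Alive (c n j : ℕ) : Prop :=
  ∀ m < n, R ((c, codedString j.unpair.1), j.unpair.2, m)

open scoped Classical in
/-- The strings of length `n` that extend the string coded by some `i < j` alive at stage `n`,
listed without repetition in the order of the least such `i`. -/
noncomputable def listing (c n : ℕ) : ℕ → List (List Bool)
  | 0 => []
  | j + 1 => listing c n j ++ (boolStrings n).filter fun y =>
      (Alive R c n j ∧ codedString j.unpair.1 <+: y) ∧ ¬ ∃ z ∈ listing c n j, z = y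

variable {R}

theorem mem_listing {c n j : ℕ} {y : List Bool} : y ∈ listing R c n j ↔
    y.length = n ∧ ∃ i < j, Alive R c n i ∧ codedString i.unpair.1 <+: y := by
  induction j with
  | zero => simp [listing]
  | succ j ih =>
    simp only [listing, List.mem_append, ih, List.mem_filter, mem_boolStrings, exists_eq_right,
      decide_eq_true_eq]
    constructor
    · rintro (⟨h, i, hi, hy⟩ | ⟨h, hy, -⟩)
      · exact ⟨h, i, hi.trans (Nat.lt_succ_self j), hy⟩
      · exact ⟨h, j, Nat.lt_succ_self j, hy⟩
    · rintro ⟨h, i, hi, hy⟩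
      by_cases hj : ∃ i < j, Alive R c n i ∧ codedString i.unpair.1 <+: y
      · exact .inl ⟨h, hj⟩
      · obtain rfl : i = j := by
          by_contra hne
          exact hj ⟨i, by omega, hy⟩
        exact .inr ⟨h, hy, fun h' => hj h'.2⟩

theorem nodup_listing (c n j : ℕ) : (listing R c n j).Nodup := by
  induction j with
  | zero => simp [listing]
  | succ j ih =>
    rw [listing, List.nodup_append']
    refine ⟨ih, (nodup_boolStrings n).filter _, fun y h1 h2 => ?_⟩
    simp only [List.mem_filter, exists_eq_right, decide_eq_true_eq] at h2
    exact h2.2.2 h1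

/-- Later candidates, possibly false ones, are only appended, so they cannot spoil the indices of
earlier strings. -/
theorem listing_prefix {c n i j : ℕ} (h : i ≤ j) : listing R c n i <+: listing R c n j := by
  induction j, h using Nat.le_induction with
  | base => exact List.prefix_refl _
  | succ j _ ih => exact ih.trans (List.prefix_append _ _)

theorem primrecPred_alive (hR : PrimrecPred R) :
    PrimrecPred fun z : (ℕ × ℕ) × ℕ => Alive R z.1.1 z.1.2 z.2 := by
  have hj : Primrec fun w : ℕ × (ℕ × ℕ) × ℕ => w.2.2.unpair :=
    Primrec.unpair.comp (Primrec.snd.comp Primrec.snd)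
  exact ((PrimrecRel.forall_mem_list (R := fun (m : ℕ) (z : (ℕ × ℕ) × ℕ) =>
    R ((z.1.1, codedString z.2.unpair.1), z.2.unpair.2, m))
    (hR.comp (((Primrec.fst.comp (Primrec.fst.comp Primrec.snd)).pair
      (primrec_codedString.comp (Primrec.fst.comp hj))).pair
        ((Primrec.snd.comp hj).pair Primrec.fst)))).comp
    (Primrec.list_range.comp (Primrec.snd.comp Primrec.fst)) Primrec.id).of_eq fun z => by
      simp [Alive]

theorem primrec_listing (hR : PrimrecPred R) :
    Primrec fun z : ℕ × ℕ => listing R z.1 z.2 z.2 := by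
  classical
  have hstep : Primrec₂ fun (z : ℕ × ℕ) (w : ℕ × List (List Bool)) =>
      w.2 ++ (boolStrings z.2).filter fun y =>
        (Alive R z.1 z.2 w.1 ∧ codedString w.1.unpair.1 <+: y) ∧ ¬ ∃ z ∈ w.2, z = y := by
    refine Primrec.list_append.comp (Primrec.snd.comp Primrec.snd) (primrec_filter
      (p := fun u : List Bool × (ℕ × ℕ) × ℕ × List (List Bool) =>
        (Alive R u.2.1.1 u.2.1.2 u.2.2.1 ∧ codedString u.2.2.1.unpair.1 <+: u.1) ∧
          ¬ ∃ z ∈ u.2.2.2, z = u.1)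
      (primrec_boolStrings.comp (Primrec.snd.comp Primrec.fst)) ?_)
    have hj : Primrec fun u : List Bool × (ℕ × ℕ) × ℕ × List (List Bool) => u.2.2.1 :=
      Primrec.fst.comp (Primrec.snd.comp Primrec.snd)
    refine PrimrecPred.and (PrimrecPred.and
      ((primrecPred_alive hR).comp ((Primrec.fst.comp Primrec.snd).pair hj))
      (primrecPred_prefix (primrec_codedString.comp
        (Primrec.fst.comp (Primrec.unpair.comp hj))) Primrec.fst)) (PrimrecPred.not ?_)
    exact primrecPred_exists_mem (f := fun u : List Bool × (ℕ × ℕ) × ℕ × List (List Bool) =>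
      u.2.2.2) (p := fun v => v.1 = v.2.1) (Primrec.snd.comp (Primrec.snd.comp Primrec.snd))
      (Primrec.eq.comp Primrec.fst (Primrec.fst.comp Primrec.snd))
  refine (Primrec.nat_rec' Primrec.snd (Primrec.const []) hstep).of_eq fun z => ?_
  obtain ⟨c, n⟩ := z
  have : ∀ j : ℕ, (j.rec [] fun i L => L ++ (boolStrings n).filter fun y =>
      (Alive R c n i ∧ codedString i.unpair.1 <+: y) ∧ ¬ ∃ z ∈ L, z = y : List (List Bool)) =
      listing R c n j := by
    intro j
    induction j with
    | zero => rfl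
    | succ j ih =>
      rw [listing, ← ih]
  exact this n

/-- All sufficiently long extensions of a string in the test set have a small index in the
listing. -/
theorem exists_index {V : ℕ → Set (List Bool)}
    (hV : ∀ a : ℕ × List Bool, a.2 ∈ V a.1 ↔ ∃ k, ∀ m, R (a, k, m)) {c : ℕ}
    (hc : coinMeasure (openOf (V c)) ≤ 2⁻¹ ^ c) {x : List Bool} (hx : x ∈ V c) :
    ∃ N, ∀ y, x <+: y → N ≤ y.length →
      ∃ i, (listing R c y.length y.length)[i]? = some y ∧ (i + 1) * 2 ^ c ≤ 2 ^ y.length := by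
  obtain ⟨k, hk⟩ := (hV (c, x)).1 hx
  -- For every candidate this provides a refutation time, unless its string really lies in the test
  -- set.
  have href : ∀ i : ℕ, ∃ m, ¬ R ((c, codedString i.unpair.1), i.unpair.2, m) ∨
      codedString i.unpair.1 ∈ V c := by
    intro i
    by_cases hi : ∃ m, ¬ R ((c, codedString i.unpair.1), i.unpair.2, m)
    · exact hi.imp fun m => .inl
    · push Not at hi
      exact ⟨0, .inr ((hV (c, _)).2 ⟨_, hi⟩)⟩
  choose g hg using href
  set j := Nat.pair (encode x) k with hj
  -- The first summand exceeds the chosen refutation times of all candidates up to `j`; the last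
  -- ensures `j + 1 ≤ n`, so that the listing up to `j` is an initial part of the full one.
  refine ⟨(Finset.range (j + 1)).sup g + 1 + (j + 1), fun y hxy hN => ?_⟩
  set n := y.length with hn
  have hy : y ∈ listing R c n (j + 1) := mem_listing.2
    ⟨rfl, j, Nat.lt_succ_self j, fun m _ => by simpa [hj] using hk m, by simpa [hj] using hxy⟩
  have hcard : (listing R c n (j + 1)).length ≤ (levelExt (V c) n).card := by
    rw [← List.toFinset_card_of_nodup (nodup_listing c n (j + 1))]
    refine Finset.card_le_card fun z hz => ?_
    obtain ⟨h1, i, hi, hal, hiz⟩ := mem_listing.1 (List.mem_toFinset.1 hz)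
    refine mem_levelExt.2 ⟨h1, _, (hg i).resolve_left ?_, hiz⟩
    have : g i ≤ (Finset.range (j + 1)).sup g := Finset.le_sup (Finset.mem_range.2 hi)
    exact not_not.2 (hal _ (by omega))
  obtain ⟨i, hi, hiy⟩ := List.getElem_of_mem hy
  refine ⟨i, ?_, (Nat.mul_le_mul_right _ ((Nat.succ_le_of_lt hi).trans hcard)).trans
    (card_levelExt_le hc n)⟩
  obtain ⟨t, ht⟩ := listing_prefix (R := R) (c := c) (n := n) (by omega : j + 1 ≤ n)
  rw [← ht, List.getElem?_append_left hi]
  exact List.getElem?_eq_some_iff.2 ⟨hi, hiy⟩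

variable (R) in
/-- The decompressor: `1 … 1 0 q`, with `c` leading ones, describes the string in the listing for
the `2 c`-th test set, at length `|q| + 2 c`, whose index is that of `q` among the strings of its
length. -/
noncomputable def decompress (w : List Bool) : Option (List Bool) :=
  let c := w.idxOf false
  let q := w.drop (c + 1)
  let n := q.length + 2 * c
  (listing R (2 * c) n n)[(boolStrings q.length).idxOf q]?

theorem primrec_decompress (hR : PrimrecPred R) : Primrec (decompress R) := by
  have hc : Primrec fun w : List Bool => w.idxOf false :=
    Primrec.list_idxOf.comp (Primrec.const false) Primrec.id
  have hq : Primrec fun w : List Bool => w.drop (w.idxOf false + 1) :=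
    Primrec.list_drop.comp (Primrec.succ.comp hc) Primrec.id
  have hl : Primrec fun w : List Bool => (w.drop (w.idxOf false + 1)).length :=
    Primrec.list_length.comp hq
  have h2 : Primrec fun w : List Bool => 2 * w.idxOf false :=
    Primrec.nat_mul.comp (Primrec.const 2) hc
  exact Primrec.list_getElem?.comp
    ((primrec_listing hR).comp (h2.pair (Primrec.nat_add.comp hl h2)))
    ((Primrec.list_idxOf.comp hq (primrec_boolStrings.comp hl)).of_eq fun w => by
      rw [lawful_beq_subsingleton instBEqOfDecidableEq List.instBEq])

/-- The index fits into `|y| - 2 * c` bits, and the self-delimiting prefix costs `c + 1` more: a net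
saving of `c - 1`. The length of `y` need not be encoded, being recovered from that of the index
block. -/
theorem exists_decompress_eq {c i : ℕ} {y : List Bool}
    (hi : (listing R (2 * c) y.length y.length)[i]? = some y)
    (hle : (i + 1) * 2 ^ (2 * c) ≤ 2 ^ y.length) :
    ∃ w, decompress R w = some y ∧ w.length + c = y.length + 1 := by
  have hcn : 2 * c ≤ y.length := (Nat.pow_le_pow_iff_right (by norm_num : 1 < 2)).1
    ((Nat.le_mul_of_pos_left _ (Nat.succ_pos i)).trans hle)
  obtain ⟨m, hm⟩ := Nat.exists_eq_add_of_le' hcn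
  have him : i < (boolStrings m).length := by
    rw [length_boolStrings]
    rw [hm, pow_add] at hle
    exact Nat.lt_of_succ_le (Nat.le_of_mul_le_mul_right hle (by positivity))
  have hq : ((boolStrings m)[i]).length = m := mem_boolStrings.1 (List.getElem_mem him)
  refine ⟨List.replicate c true ++ false :: (boolStrings m)[i], ?_, by simp; omega⟩
  have hidx : (List.replicate c true ++ false :: (boolStrings m)[i]).idxOf false = c := by
    rw [List.idxOf_append_of_notMem (by simp [List.mem_replicate])]
    simp
  have hdrop : (List.replicate c true ++ false :: (boolStrings m)[i]).drop (c + 1) =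
      (boolStrings m)[i] := by
    rw [List.drop_append]
    simp
  simp only [decompress, hidx, hdrop, hq, (nodup_boolStrings m).idxOf_getElem, ← hm, hi]

end StagedTest

theorem isMLRandom_of_extDeficiency_le {D : List Bool →. List Bool} (hD : IsOptimalMethod D)
    {ω : ℕ → Bool} {b : ℤ} (hb : ∀ n, extDeficiency D (initSeg ω n) ≤ b) :
    IsMLRandom zeroJump ω := by
  rintro V ⟨hre, hV⟩
  by_contra! hω
  obtain ⟨R, hR, h⟩ := hre.isSigmaTwo
  obtain ⟨c₀, hc₀⟩ := hD.2 (fun w => (StagedTest.decompress R w : Part (List Bool)))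
    (StagedTest.primrec_decompress hR).to_comp.ofOption
  -- The compression yields deficiency at least `c - 1 - c₀`, which must exceed `b`.
  obtain ⟨c, hc⟩ : ∃ c : ℕ, b + c₀ + 1 < c := ⟨(b + c₀ + 2).toNat, by omega⟩
  obtain ⟨l, hl⟩ := mem_openOf.1 (hω (2 * c))
  obtain ⟨N, hN⟩ := StagedTest.exists_index h (hV (2 * c)) hl
  -- This prefix extends the test string of length `l`, and all its extensions are long enough to be
  -- compressed.
  have hlow : b + 1 ≤ extDeficiency D (initSeg ω (max N l)) := by
    refine (hD.isGLB _).2 ?_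
    rintro _ ⟨y, hy, rfl⟩
    have hlen := hy.length_le
    rw [length_initSeg] at hlen
    obtain ⟨i, hi, hle⟩ := hN y ((initSeg_prefix ω (le_max_right N l)).trans hy) (by omega)
    obtain ⟨w, hw, hwl⟩ := StagedTest.exists_decompress_eq hi hle
    have h1 : plainComplexity D y ≤ ((w.length + c₀ : ℕ) : ℕ∞) := by
      refine (hc₀ y).trans ?_
      push_cast
      gcongr
      exact plainComplexity_le (by simp [hw])
    have h2 := ENat.toNat_le_of_le_natCast h1
    unfold deficiency
    omega
  have := hb (max N l)
  omega

theorem theorem7 (D : List Bool →. List Bool) (hD : IsOptimalMethod D) (ω : ℕ → Bool) :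
    IsMLRandom zeroJump ω ↔
      ∃ c : ℤ, ∀ n : ℕ, extDeficiency D (initSeg ω n) ≤ c :=
  ⟨fun h => h.exists_extDeficiency_le hD, fun ⟨_, h⟩ => isMLRandom_of_extDeficiency_le hD h⟩
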